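/- Let $K$ and $N$ be finite groups (not necessarily Abelian) of orders $m$ and $n$, with $n\ge 2$, and let $f:K\to N$ be any function. For a finite group $G$, let $\widehat G$ denote the set of equivalence classes of irreducible complex representations of $G$. Every irreducible representation $\rho$ of $K\times N$ is equivalent to $\rho_K\otimes\rho_N$, $(k,x)\mapsto\rho_K(k)\otimes\rho_N(x)$, for irreducible representations $\rho_K$ of $K$ and $\rho_N$ of $N$, unique up to equivalence; $\rho$ is called nonprincipal on $N$ if $\rho_N$ is not the trivial one-dimensional representation $\rho_0$ of $N$. Put $\rho(D_f)=\sum_{a\in K}\rho(a,f(a))$ and $\|\varphi\|=\sqrt{\operatorname{tr}(\varphi\circ\varphi^*)}$, where $\varphi^*$ is the adjoint. Then, with $\rho$ ranging over the unitary irreducible representations of $K\times N$ that are nonprincipal on $N$, the maximum below is attained and $$\max_{\rho_N\ne\rho_0}\dim\rho\,\|\rho(D_f)\|^2\;\ge\;\frac{m^2(n-1)}{|\widehat K|\,(|\widehat N|-1)}.$$ Moreover, equality holds if and only if $f$ is bent, that is, if and only if for every unitary irreducible representation $\rho$ of $K\times N$ that is nonprincipal on $N$, $$\|\rho(D_f)\|^2=\frac{m^2(n-1)}{\dim\rho\,|\widehat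 K|\,(|\widehat N|-1)}.$$ -/

import Mathlib

noncomputable section

/-- A finite-dimensional irreducible complex representation of `G`, realised on the Hermitian
space `ℂ ^ dim`. (Every finite-dimensional complex representation is equivalent to one on such a
space; irreducible representations are nonzero, so `dim ≥ 1`.) -/
structure IrrRep (G : Type*) [Group G] where
  /-- The dimension of the representation. -/
  dim : ℕ
  /-- The homomorphism from `G` to the linear endomorphisms. -/
  rep : Representation ℂ G (EuclideanSpace ℂ (Fin dim))
  irreducible : rep.IsIrreducible

namespace IrrRep

variable {G : Type*} [Group G]

/-- Equivalence of representations: there is a linear isomorphism intertwining them. -/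
instance setoid (G : Type*) [Group G] : Setoid (IrrRep G) where
  r ρ σ := Nonempty (ρ.rep.Equiv σ.rep)
  iseqv :=
    { refl := fun _ => ⟨Representation.Equiv.refl _⟩
      symm := fun ⟨e⟩ => ⟨e.symm⟩
      trans := fun ⟨e⟩ ⟨e'⟩ => ⟨e.trans e'⟩ }

/-- `ρ` is unitary: `ρ(g⁻¹) = ρ(g)*` for all `g`. -/
def IsUnitary (ρ : IrrRep G) : Prop :=
  ∀ g : G, ρ.rep g⁻¹ = LinearMap.adjoint (ρ.rep g)

/-- `ρ` is (equivalent to) the principal representation, the trivial representation on `ℂ`. -/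
def IsPrincipal (ρ : IrrRep G) : Prop :=
  Nonempty (ρ.rep.Equiv (Representation.trivial ℂ G ℂ))

end IrrRep

/-- The dual of `G`: the equivalence classes of irreducible representations of `G`. -/
def IrrDual (G : Type*) [Group G] : Type _ :=
  Quotient (IrrRep.setoid G)

/-- The representation `(k, n) ↦ σ(k) ⊗ τ(n)` of `K × N`. -/
def outerTensor {K N V W : Type*} [Group K] [Group N] [AddCommGroup V] [Module ℂ V]
    [AddCommGroup W] [Module ℂ W] (σ : Representation ℂ K V) (τ : Representation ℂ N W) :
    Representation ℂ (K × N) (TensorProduct ℂ V W) :=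
  Representation.tprod (σ.comp (MonoidHom.fst K N)) (τ.comp (MonoidHom.snd K N))

/-- `ρ` is nonprincipal on `N`: it is equivalent to `ρ_K ⊗ ρ_N` with `ρ_K`, `ρ_N` irreducible
representations of `K` and `N` such that `ρ_N` is not the principal representation of `N`. -/
def IrrRep.NonprincipalOnSnd {K N : Type*} [Group K] [Group N] (ρ : IrrRep (K × N)) : Prop :=
  ∃ (σ : IrrRep K) (τ : IrrRep N),
    Nonempty (ρ.rep.Equiv (outerTensor σ.rep τ.rep)) ∧ ¬ τ.IsPrincipal

/-- The norm `‖φ‖ = √(tr (φ ∘ φ*))` of an endomorphism of a Hermitian space (the trace is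
real and nonnegative). -/
def traceNorm {V : Type*} [NormedAddCommGroup V] [InnerProductSpace ℂ V]
    [FiniteDimensional ℂ V] (φ : Module.End ℂ V) : ℝ :=
  Real.sqrt (LinearMap.trace ℂ V (φ ∘ₗ LinearMap.adjoint φ)).re

/-- The graph `D_f = {(a, f a) | a ∈ K}` as an element of the group algebra `ℂ[K × N]`. -/
def graphElement {K N : Type*} [Group K] [Fintype K] [Group N] (f : K → N) :
    MonoidAlgebra ℂ (K × N) :=
  ∑ a : K, MonoidAlgebra.of ℂ (K × N) (a, f a)

/-- `‖ρ(D_f)‖`, where `ρ` is extended linearly to the group algebra. -/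
def graphNorm {K N : Type*} [Group K] [Fintype K] [Group N] (f : K → N)
    (ρ : IrrRep (K × N)) : ℝ :=
  traceNorm (ρ.rep.asAlgebraHom (graphElement f))

/-- The function `f : K → N` is bent: for every unitary irreducible `ρ` that is nonprincipal on
`N`, one has `‖ρ(D_f)‖² = m² (n - 1) / (dim ρ · |K̂| (|N̂| - 1))`. -/
def IsBent {K N : Type*} [Group K] [Fintype K] [Group N] [Fintype N] (f : K → N) : Prop :=
  ∀ ρ : IrrRep (K × N), ρ.IsUnitary → ρ.NonprincipalOnSnd →
    graphNorm f ρ ^ 2 =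
      (Fintype.card K : ℝ) ^ 2 * ((Fintype.card N : ℝ) - 1) /
        ((ρ.dim : ℝ) * ((Nat.card (IrrDual K) : ℝ) * ((Nat.card (IrrDual N) : ℝ) - 1)))

end

/-!
For a unitary irreducible representation `ρ` of `K × N` the square `‖ρ(D_f)‖²` is the trace of the
image of `∑ (a, f a) (b, f b)⁻¹`, hence a sum of values of the character of `ρ`
(`sq_graphNorm`). If `ρ ≅ σ ⊗ τ`, then `dim ρ ‖ρ(D_f)‖²` therefore depends only on the classes of
`σ` and `τ`; call it the energy of the pair (`graphEnergy`). Conversely every pair of classes comes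
from a unitary irreducible `ρ`: an outer tensor product of irreducible representations is
irreducible because its endomorphism algebra is one-dimensional
(`Representation.IsIrreducible.outerTensor`), and every representation of a finite group is
equivalent to a unitary one (`Representation.exists_equiv_unitary`).

The set whose maximum is sought is thus the set of energies of the `|K̂| (|N̂| - 1)` pairs with
nonprincipal second component. The decomposition `∑ dim(s) χ_s = |G| δ_1` of the regular character
(`IrrDual.sum_dim_mul_character`), for `K` and for `N`, shows that these energies add up to
`m² (n - 1)` (`sum_graphEnergy`). So the bound is the average energy: the maximum is at least the
average, with equality if and only if all energies are equal to it, which is bentness.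

The regular character is computed from the orthogonality of the irreducible characters, which
is in Mathlib, and their completeness (`eq_zero_of_forall_sum_character_eq_zero`): a class function
orthogonal to all irreducible characters gives an element of `ℂ[G]` that annihilates all simple
modules, and the Jacobson radical of `ℂ[G]` is zero.
-/

open Module Representation

/-! ### Irreducibility, unitarity and outer tensor products -/

namespace Representation

section Equivalence

variable {k G V W : Type*} [Field k] [Group G] [AddCommGroup V] [Module k V] [AddCommGroup W]
  [Module k W] {ρ : Representation k G V} {σ : Representation k G W}

theorem IsIrreducible.of_equiv (e : ρ.Equiv σ) (h : ρ.IsIrreducible) : σ.IsIrreducible := by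
  rw [irreducible_iff_isSimpleModule_asModule] at h ⊢
  let f := IntertwiningMap.equivLinearMapAsModule ρ σ e.toIntertwiningMap
  have hf : Function.Bijective f := e.toLinearEquiv.bijective
  exact IsSimpleModule.congr (LinearEquiv.ofBijective f hf).symm

/-- The converse of Schur's lemma for completely reducible representations: the projection onto
an invariant subspace along an invariant complement is a scalar, so the subspace is trivial. -/
theorem isIrreducible_of_finrank_intertwiningMap [IsSemisimpleModule (MonoidAlgebra k G) ρ.asModule]
    (h : finrank k (IntertwiningMap ρ ρ) = 1) : ρ.IsIrreducible := by
  rw [irreducible_iff_isSimpleModule_asModule, isSimpleModule_iff]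
  have h' : finrank k (Module.End (MonoidAlgebra k G) ρ.asModule) = 1 := by
    rw [← h]
    exact (IntertwiningMap.equivLinearMapAsModule ρ ρ).finrank_eq.symm
  have hnt : Nontrivial ρ.asModule := by
    by_contra hn
    rw [not_nontrivial_iff_subsingleton] at hn
    have : Subsingleton (Module.End (MonoidAlgebra k G) ρ.asModule) :=
      ⟨fun f g => LinearMap.ext fun x => Subsingleton.elim _ _⟩
    rw [finrank_zero_of_subsingleton] at h'
    exact zero_ne_one h'
  have key : ∀ p : Submodule (MonoidAlgebra k G) ρ.asModule, p = ⊥ ∨ p = ⊤ := by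
    intro p
    obtain ⟨q, hpq⟩ := exists_isCompl p
    have h1 : (1 : Module.End (MonoidAlgebra k G) ρ.asModule) ≠ 0 := one_ne_zero
    obtain ⟨c, hc⟩ := (finrank_eq_one_iff_of_nonzero' _ h1).1 h' (p.projection q hpq)
    have hc' : ∀ x, p.projection q hpq x = c • x := fun x => by rw [← hc]; rfl
    by_cases h0 : c = 0
    · left
      rw [eq_bot_iff]
      intro x hx
      have := hc' x
      rw [h0, zero_smul] at this
      rw [Submodule.projection_apply_of_mem_left hpq hx] at this
      simpa using this
    · right
      rw [eq_top_iff]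
      intro x _
      have hx : p.projection q hpq (c⁻¹ • x) = x := by
        rw [hc', smul_smul, mul_inv_cancel₀ h0, one_smul]
      rw [← hx]
      exact Submodule.projection_apply_mem hpq _
  exact { exists_pair_ne := ⟨⊥, ⊤, bot_ne_top⟩, eq_bot_or_eq_top := key }

end Equivalence

section Unitary

variable {G V : Type*} [Group G] [Finite G] [AddCommGroup V] [Module ℂ V] [FiniteDimensional ℂ V]

/-- Weyl's unitary trick. Averaging a Hermitian inner product over `G` amounts to embedding `V`
into the Hermitian space `(ℂ ^ d) ^ G` by `v ↦ (ρ(g) v)_g`. -/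
theorem exists_equiv_unitary (ρ : Representation ℂ G V) :
    ∃ (d : ℕ) (σ : Representation ℂ G (EuclideanSpace ℂ (Fin d))), Nonempty (ρ.Equiv σ) ∧
      ∀ g, σ g⁻¹ = LinearMap.adjoint (σ g) := by
  have := Fintype.ofFinite G
  let b := Module.finBasis ℂ V
  let Φ : V →ₗ[ℂ] EuclideanSpace ℂ (G × Fin (finrank ℂ V)) :=
    (WithLp.linearEquiv 2 ℂ (G × Fin (finrank ℂ V) → ℂ)).symm.toLinearMap ∘ₗ
      LinearMap.pi fun x => b.coord x.2 ∘ₗ ρ x.1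
  have hΦ : ∀ v x, Φ v x = b.repr (ρ x.1 v) x.2 := fun v x => rfl
  have hinj : Function.Injective Φ := by
    intro v w hvw
    apply b.repr.injective
    ext i
    have := congrArg (fun y => y (1, i)) hvw
    simpa [hΦ] using this
  let e₁ : V ≃ₗ[ℂ] LinearMap.range Φ := LinearEquiv.ofInjective Φ hinj
  let e : V ≃ₗ[ℂ] EuclideanSpace ℂ (Fin (finrank ℂ (LinearMap.range Φ))) :=
    e₁.trans (stdOrthonormalBasis ℂ (LinearMap.range Φ)).repr.toLinearEquiv
  have hinner : ∀ v w, inner ℂ (e v) (e w) = inner ℂ (Φ v) (Φ w) := by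
    intro v w
    exact (stdOrthonormalBasis ℂ (LinearMap.range Φ)).repr.inner_map_map (e₁ v) (e₁ w)
  -- reindexing the sum over `G` shows that the averaged inner product is invariant
  have hinv : ∀ g v w, inner ℂ (Φ (ρ g v)) (Φ (ρ g w)) = inner ℂ (Φ v) (Φ w) := by
    intro g v w
    simp only [PiLp.inner_apply]
    refine Fintype.sum_equiv ((_root_.Equiv.mulRight g).prodCongr (_root_.Equiv.refl _)) _ _ ?_
    rintro ⟨h, i⟩
    simp [hΦ, map_mul]
  let σ : Representation ℂ G (EuclideanSpace ℂ (Fin (finrank ℂ (LinearMap.range Φ)))) :=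
    { toFun := fun g => e.conj (ρ g)
      map_one' := by rw [map_one]; exact e.conj_id
      map_mul' := fun g h => by
        rw [map_mul]
        exact e.conj_comp (ρ h) (ρ g) }
  have hσ : ∀ g v, σ g (e v) = e (ρ g v) := fun g v => by
    simp [σ, LinearEquiv.conj_apply_apply]
  refine ⟨_, σ, ⟨Equiv.mk e fun g => ?_⟩, fun g => ?_⟩
  · ext1 v
    exact (hσ g v).symm
  · rw [LinearMap.eq_adjoint_iff]
    intro x y
    obtain ⟨v, rfl⟩ := e.surjective x
    obtain ⟨w, rfl⟩ := e.surjective y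
    rw [hσ, hσ, hinner, hinner, ← hinv g, self_inv_apply]

end Unitary

end Representation

theorem IrrRep.exists_isUnitary_equiv {G V : Type*} [Group G] [Finite G] [AddCommGroup V]
    [Module ℂ V] [FiniteDimensional ℂ V] (ρ : Representation ℂ G V) (h : ρ.IsIrreducible) :
    ∃ σ : IrrRep G, σ.IsUnitary ∧ Nonempty (ρ.Equiv σ.rep) := by
  obtain ⟨d, σ, ⟨e⟩, hσ⟩ := exists_equiv_unitary ρ
  exact ⟨⟨d, σ, h.of_equiv e⟩, hσ, ⟨e⟩⟩

section OuterTensor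

variable {K N V W : Type*} [Group K] [Group N] [AddCommGroup V] [Module ℂ V]
  [AddCommGroup W] [Module ℂ W] [FiniteDimensional ℂ V] [FiniteDimensional ℂ W]

theorem character_outerTensor (σ : Representation ℂ K V) (τ : Representation ℂ N W) (x : K × N) :
    (outerTensor σ τ).character x = σ.character x.1 * τ.character x.2 :=
  LinearMap.trace_tensorProduct' (σ x.1) (τ x.2)

theorem Representation.IsIrreducible.outerTensor [Finite K] [Finite N] {σ : Representation ℂ K V}
    {τ : Representation ℂ N W} (hσ : σ.IsIrreducible) (hτ : τ.IsIrreducible) :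
    (outerTensor σ τ).IsIrreducible := by
  have := Fintype.ofFinite K
  have := Fintype.ofFinite N
  have hK : Invertible (Nat.card K : ℂ) := invertibleOfNonzero (by simp)
  have hN : Invertible (Nat.card N : ℂ) := invertibleOfNonzero (by simp)
  have hKN : Invertible (Nat.card (K × N) : ℂ) := invertibleOfNonzero (by simp)
  have : NeZero (Nat.card (K × N) : ℂ) := ⟨by simp⟩
  apply isIrreducible_of_finrank_intertwiningMap
  have h1 := card_inv_mul_sum_char_mul_char_eq_finrank (_root_.outerTensor σ τ)
    (_root_.outerTensor σ τ)
  have h2 := card_inv_mul_sum_char_mul_char_eq_finrank σ σ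
  have h3 := card_inv_mul_sum_char_mul_char_eq_finrank τ τ
  rw [IsIrreducible.finrank_intertwiningMap_self] at h2 h3
  have h4 : (finrank ℂ (IntertwiningMap (_root_.outerTensor σ τ) (_root_.outerTensor σ τ)) : ℂ) =
      ((1 : ℕ) : ℂ) * ((1 : ℕ) : ℂ) := by
    rw [← h1]
    nth_rw 1 [← h2]
    rw [← h3, Nat.card_prod, mul_mul_mul_comm, Finset.sum_mul_sum, Fintype.sum_prod_type]
    simp only [character_outerTensor, Nat.cast_mul, mul_inv, Prod.fst_inv, Prod.snd_inv]
    congr 1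
    exact Finset.sum_congr rfl fun a _ => Finset.sum_congr rfl fun b _ => by ring
  exact_mod_cast h4

end OuterTensor

/-! ### The dual of a finite group and its characters -/

theorem Representation.IsIrreducible.finrank_ne_zero {G V : Type*} [Group G] [AddCommGroup V]
    [Module ℂ V] [FiniteDimensional ℂ V] {ρ : Representation ℂ G V} (h : ρ.IsIrreducible) :
    finrank ℂ V ≠ 0 := by
  intro h0
  have h1 := IsIrreducible.finrank_intertwiningMap_self ρ
  have : Subsingleton V := finrank_zero_iff.1 h0
  have : Subsingleton (IntertwiningMap ρ ρ) :=
    ⟨fun f g => DFunLike.ext _ _ fun x => Subsingleton.elim _ _⟩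
  rw [finrank_zero_of_subsingleton] at h1
  exact zero_ne_one h1

namespace IrrDual

variable {G : Type*} [Group G]

/-- The common dimension of the representations in a class. -/
def dim (s : IrrDual G) : ℕ :=
  Quotient.lift IrrRep.dim (fun ρ σ (h : Nonempty (ρ.rep.Equiv σ.rep)) => by
    simpa using h.some.toLinearEquiv.finrank_eq) s

/-- The common character of the representations in a class. -/
noncomputable def character (s : IrrDual G) : G → ℂ :=
  Quotient.lift (fun ρ : IrrRep G => ρ.rep.character)
    (fun ρ σ (h : Nonempty (ρ.rep.Equiv σ.rep)) => char_iso h.some) s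

/-- The class of an irreducible representation. -/
def mk (ρ : IrrRep G) : IrrDual G := Quotient.mk _ ρ

theorem mk_surjective : Function.Surjective (mk : IrrRep G → IrrDual G) := Quotient.mk_surjective

theorem mk_eq_mk {ρ σ : IrrRep G} : mk ρ = mk σ ↔ Nonempty (ρ.rep.Equiv σ.rep) := Quotient.eq

@[simp] theorem dim_mk (ρ : IrrRep G) : (mk ρ).dim = ρ.dim := rfl

@[simp] theorem character_mk (ρ : IrrRep G) : (mk ρ).character = ρ.rep.character := rfl

theorem character_one (s : IrrDual G) : s.character 1 = s.dim := by
  obtain ⟨ρ, rfl⟩ := mk_surjective s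
  simp

theorem character_conj (s : IrrDual G) (g h : G) :
    s.character (h * g * h⁻¹) = s.character g := by
  obtain ⟨ρ, rfl⟩ := mk_surjective s
  exact char_conj ρ.rep g h

open scoped Classical in
theorem sum_character_mul_character_inv [Fintype G] (s t : IrrDual G) :
    ∑ g, s.character g * t.character g⁻¹ = if s = t then (Fintype.card G : ℂ) else 0 := by
  obtain ⟨ρ, rfl⟩ := mk_surjective s
  obtain ⟨σ, rfl⟩ := mk_surjective t
  have hG : Invertible (Nat.card G : ℂ) := invertibleOfNonzero (by simp)
  have := ρ.irreducible
  have := σ.irreducible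
  have h := char_orthonormal ρ.rep σ.rep
  rw [inv_mul_eq_iff_eq_mul₀ (by simp)] at h
  rw [eq_comm (a := mk ρ), mk_eq_mk, character_mk, character_mk, h, mul_ite, mul_one, mul_zero,
    Nat.card_eq_fintype_card]

/-- The irreducible characters are orthogonal, hence linearly independent in `G → ℂ`. -/
instance finite [Finite G] : Finite (IrrDual G) := by
  classical
  have := Fintype.ofFinite G
  let B : LinearMap.BilinForm ℂ (G → ℂ) := LinearMap.mk₂ ℂ (fun φ ψ => ∑ g, φ g * ψ g⁻¹)
    (fun φ φ' ψ => by simp [add_mul, Finset.sum_add_distrib])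
    (fun c φ ψ => by simp [Finset.mul_sum, mul_assoc])
    (fun φ ψ ψ' => by simp [mul_add, Finset.sum_add_distrib])
    (fun c φ ψ => by simp [Finset.mul_sum, mul_left_comm])
  have hB : ∀ s t : IrrDual G, B s.character t.character =
      if s = t then (Fintype.card G : ℂ) else 0 :=
    sum_character_mul_character_inv
  have hli : LinearIndependent ℂ (character : IrrDual G → G → ℂ) := by
    apply LinearMap.BilinForm.linearIndependent_of_iIsOrtho (B := B)
    · rw [LinearMap.BilinForm.iIsOrtho_def]
      intro s t hst
      rw [hB, if_neg hst]
    · intro s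
      rw [hB, if_pos rfl]
      simp
  exact hli.finite

end IrrDual

/-! ### Completeness of the irreducible characters -/

section Completeness

variable {G : Type*} [Group G] [Fintype G]

/-- By Schur's lemma the central element `∑ φ(g) g⁻¹` acts as a scalar, and the trace of this
scalar is the pairing of `φ` with the character. -/
theorem asAlgebraHom_eq_zero_of_sum_character_eq_zero {V : Type*} [AddCommGroup V] [Module ℂ V]
    [FiniteDimensional ℂ V] {ρ : Representation ℂ G V} (hρ : ρ.IsIrreducible) {φ : G → ℂ}
    (hφ : ∀ g h, φ (h * g * h⁻¹) = φ g) (h : ∑ g, φ g * ρ.character g⁻¹ = 0) :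
    ρ.asAlgebraHom (∑ g, MonoidAlgebra.single g⁻¹ (φ g)) = 0 := by
  have hz : ρ.asAlgebraHom (∑ g, MonoidAlgebra.single g⁻¹ (φ g)) = ∑ g, φ g • ρ g⁻¹ := by
    simp [map_sum]
  rw [hz]
  let T : IntertwiningMap ρ ρ :=
    { toLinearMap := ∑ g, φ g • ρ g⁻¹
      isIntertwining' := fun x => by
        rw [← Module.End.mul_eq_comp, ← Module.End.mul_eq_comp, Finset.sum_mul, Finset.mul_sum]
        refine Fintype.sum_equiv (MulAut.conj x⁻¹).toEquiv _ _ fun g => ?_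
        have : φ (MulAut.conj x⁻¹ g) = φ g := hφ g x⁻¹
        rw [MulEquiv.toEquiv_eq_coe, MulEquiv.coe_toEquiv, this, smul_mul_assoc, mul_smul_comm,
          ← map_mul, ← map_mul]
        simp [mul_assoc] }
  obtain ⟨c, hc⟩ := IsIrreducible.algebraMap_intertwiningMap_bijective_of_isAlgClosed.2 T
  have hT : ∑ g, φ g • ρ g⁻¹ = c • LinearMap.id := by
    have := congrArg IntertwiningMap.toLinearMap hc
    rw [IntertwiningMap.algebraMap_apply, IntertwiningMap.toLinearMap_smul] at this
    exact this.symm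
  have htr := congrArg (LinearMap.trace ℂ V) hT
  have : (0 : ℂ) = c * finrank ℂ V := by
    rw [← h]
    simpa [map_sum, character] using htr
  have hc0 : c = 0 := by
    rcases mul_eq_zero.1 this.symm with h | h
    · exact h
    · exact absurd (Nat.cast_eq_zero.1 h) hρ.finrank_ne_zero
  rw [hT, hc0, zero_smul]

theorem smul_eq_zero_of_forall_sum_character_eq_zero {M : Type*} [AddCommGroup M] [Module ℂ M]
    [Module (MonoidAlgebra ℂ G) M] [IsScalarTower ℂ (MonoidAlgebra ℂ G) M]
    [hM : IsSimpleModule (MonoidAlgebra ℂ G) M] {φ : G → ℂ}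
    (hφ : ∀ g h, φ (h * g * h⁻¹) = φ g)
    (h : ∀ s : IrrDual G, ∑ g, φ g * s.character g⁻¹ = 0) (m : M) :
    (∑ g, MonoidAlgebra.single g⁻¹ (φ g) : MonoidAlgebra ℂ G) • m = 0 := by
  have : FiniteDimensional ℂ M := Module.Finite.trans (MonoidAlgebra ℂ G) M
  let ρ : Representation ℂ G M := ofModule' M
  have hact : ∀ (z : MonoidAlgebra ℂ G) (x : M), ρ.asAlgebraHom z x = z • x := fun z x => by
    simp only [ρ, ofModule', asAlgebraHom_def, Equiv.apply_symm_apply]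
    rfl
  let e : ρ.asModule ≃ₗ[MonoidAlgebra ℂ G] M :=
    { ρ.asModuleEquiv.toAddEquiv with
      map_smul' := fun z x => (ρ.asModuleEquiv_map_smul z x).trans (hact z _) }
  have hρ : ρ.IsIrreducible := by
    rw [irreducible_iff_isSimpleModule_asModule]
    exact IsSimpleModule.congr e
  obtain ⟨σ, -, ⟨f⟩⟩ := IrrRep.exists_isUnitary_equiv ρ hρ
  rw [← hact, asAlgebraHom_eq_zero_of_sum_character_eq_zero hρ hφ (by
    rw [char_iso f]
    exact h (IrrDual.mk σ))]
  rfl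

/-- Completeness of the irreducible characters: `∑ φ(g) g⁻¹` annihilates every simple module,
so it lies in the Jacobson radical of the semisimple ring `ℂ[G]`. -/
theorem eq_zero_of_forall_sum_character_eq_zero {φ : G → ℂ}
    (hφ : ∀ g h, φ (h * g * h⁻¹) = φ g)
    (h : ∀ s : IrrDual G, ∑ g, φ g * s.character g⁻¹ = 0) : φ = 0 := by
  classical
  have : NeZero (Nat.card G : ℂ) := ⟨by simp⟩
  set z : MonoidAlgebra ℂ G := ∑ g, MonoidAlgebra.single g⁻¹ (φ g) with hz_def
  have hz : z ∈ Ring.jacobson (MonoidAlgebra ℂ G) := by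
    rw [Ring.jacobson_eq_sInf_isMaximal, Submodule.mem_sInf]
    intro I hI
    have hM : IsSimpleModule (MonoidAlgebra ℂ G) (MonoidAlgebra ℂ G ⧸ I) := by
      rw [isSimpleModule_iff_isCoatom]
      exact Ideal.isMaximal_def.1 hI
    have h2 : z • (Submodule.Quotient.mk 1 : MonoidAlgebra ℂ G ⧸ I) = 0 :=
      smul_eq_zero_of_forall_sum_character_eq_zero hφ h _
    rwa [← Submodule.Quotient.mk_smul, smul_eq_mul, mul_one, Submodule.Quotient.mk_eq_zero] at h2
  rw [IsSemisimpleRing.jacobson_eq_bot, Submodule.mem_bot] at hz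
  ext g
  have h1 := congrArg (fun x => x.coeff g⁻¹) hz
  simpa [hz_def, Finsupp.single_apply] using h1

namespace IrrDual

open scoped Classical in
/-- The regular representation has character `∑ dim(s) χ_s`. -/
theorem sum_dim_mul_character [Fintype (IrrDual G)] (g : G) :
    ∑ s : IrrDual G, (s.dim : ℂ) * s.character g = if g = 1 then (Fintype.card G : ℂ) else 0 := by
  let φ : G → ℂ := fun g => (∑ s : IrrDual G, (s.dim : ℂ) * s.character g) -
    if g = 1 then (Fintype.card G : ℂ) else 0
  suffices h : φ = 0 from sub_eq_zero.1 (congrFun h g)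
  apply eq_zero_of_forall_sum_character_eq_zero
  · intro g h
    simp [φ, character_conj]
  · intro t
    simp only [φ, sub_mul, Finset.sum_sub_distrib, Finset.sum_mul]
    rw [Finset.sum_comm]
    simp only [mul_assoc, ← Finset.mul_sum, sum_character_mul_character_inv]
    simp [character_one, mul_comm]

end IrrDual

end Completeness

/-! ### The energies of a graph and their average -/

theorem Finset.exists_isGreatest_average_le {ι : Type*} {S : Finset ι} (hS : S.Nonempty)
    (F : ι → ℝ) :
    ∃ M, IsGreatest (F '' S) M ∧ (∑ i ∈ S, F i) / S.card ≤ M ∧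
      (M = (∑ i ∈ S, F i) / S.card ↔ ∀ i ∈ S, F i = (∑ i ∈ S, F i) / S.card) := by
  have hcard : (0 : ℝ) < S.card := by exact_mod_cast hS.card_pos
  obtain ⟨j, hj, hmax⟩ := S.exists_max_image F hS
  have hle : ∑ i ∈ S, F i ≤ ∑ _i ∈ S, F j := Finset.sum_le_sum hmax
  refine ⟨F j, ⟨⟨j, hj, rfl⟩, ?_⟩, ?_, ?_, fun h => h j hj⟩
  · rintro _ ⟨i, hi, rfl⟩
    exact hmax i hi
  · rw [div_le_iff₀ hcard]
    simpa [mul_comm] using hle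
  · intro h i hi
    rw [← h]
    refine (Finset.sum_eq_sum_iff_of_le hmax).1 ?_ i hi
    rw [eq_div_iff hcard.ne'] at h
    rw [← h]
    simp [mul_comm]

theorem IrrDual.exists_principal (G : Type*) [Group G] [Finite G] :
    ∃ p : IrrDual G, p.dim = 1 ∧ (∀ g, p.character g = 1) ∧
      ∀ τ : IrrRep G, τ.IsPrincipal ↔ IrrDual.mk τ = p := by
  have := Fintype.ofFinite G
  have hG : Invertible (Nat.card G : ℂ) := invertibleOfNonzero (by simp)
  have : NeZero (Nat.card G : ℂ) := ⟨by simp⟩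
  have hchar : ∀ g, (trivial ℂ G ℂ).character g = 1 := fun g => by
    have : trivial ℂ G ℂ g = 1 := rfl
    rw [Representation.character, this, LinearMap.trace_one]
    simp
  have hirr : (trivial ℂ G ℂ).IsIrreducible := by
    apply isIrreducible_of_finrank_intertwiningMap
    have h := card_inv_mul_sum_char_mul_char_eq_finrank (trivial ℂ G ℂ) (trivial ℂ G ℂ)
    simp only [hchar, mul_one, Finset.sum_const, Finset.card_univ, nsmul_eq_mul,
      Nat.card_eq_fintype_card] at h
    rw [inv_mul_cancel₀ (by simp)] at h
    exact_mod_cast h.symm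
  obtain ⟨σ, -, ⟨e⟩⟩ := IrrRep.exists_isUnitary_equiv _ hirr
  refine ⟨mk σ, ?_, fun g => ?_, fun τ => ?_⟩
  · simpa using e.toLinearEquiv.finrank_eq.symm
  · rw [character_mk, ← char_iso e, hchar]
  · rw [mk_eq_mk]
    exact ⟨fun ⟨f⟩ => ⟨f.trans e⟩, fun ⟨f⟩ => ⟨f.trans e.symm⟩⟩

section Graph

variable {K N : Type*} [Group K] [Fintype K] [Group N]

theorem sq_traceNorm {V : Type*} [NormedAddCommGroup V] [InnerProductSpace ℂ V]
    [FiniteDimensional ℂ V] (φ : Module.End ℂ V) :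
    traceNorm φ ^ 2 = (LinearMap.trace ℂ V (φ ∘ₗ LinearMap.adjoint φ)).re := by
  refine Real.sq_sqrt ?_
  exact (Complex.nonneg_iff.1 (LinearMap.isPositive_self_comp_adjoint φ).trace_nonneg).1

/-- For unitary `ρ` the operator `ρ(D_f) ρ(D_f)*` is the image of `D_f D_f⁻¹` in the group
algebra, so its trace is a sum of character values. -/
theorem sq_graphNorm (f : K → N) {ρ : IrrRep (K × N)} (hρ : ρ.IsUnitary) :
    graphNorm f ρ ^ 2 =
      (∑ a, ∑ b, ρ.rep.character ((a, f a) * (b, f b)⁻¹)).re := by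
  have h : ρ.rep.asAlgebraHom (graphElement f) = ∑ a, ρ.rep (a, f a) := by
    simp [graphElement, map_sum]
  rw [graphNorm, sq_traceNorm, h, map_sum]
  congr 1
  rw [← Module.End.mul_eq_comp, Finset.sum_mul_sum, map_sum]
  refine Finset.sum_congr rfl fun a _ => ?_
  rw [map_sum]
  refine Finset.sum_congr rfl fun b _ => ?_
  rw [← hρ, ← map_mul]
  rfl

/-- The value of `dim ρ ‖ρ(D_f)‖²` for unitary `ρ` equivalent to `σ ⊗ τ`, as a function of the
classes `s` of `σ` and `t` of `τ`. -/
noncomputable def graphEnergy (f : K → N) (s : IrrDual K) (t : IrrDual N) : ℝ :=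
  (∑ a, ∑ b, ((s.dim : ℂ) * s.character (a * b⁻¹)) *
    ((t.dim : ℂ) * t.character (f a * (f b)⁻¹))).re

theorem dim_mul_sq_graphNorm (f : K → N) {ρ : IrrRep (K × N)} (hρ : ρ.IsUnitary) {σ : IrrRep K}
    {τ : IrrRep N} (e : ρ.rep.Equiv (outerTensor σ.rep τ.rep)) :
    (ρ.dim : ℝ) * graphNorm f ρ ^ 2 = graphEnergy f (IrrDual.mk σ) (IrrDual.mk τ) := by
  have hdim : ρ.dim = σ.dim * τ.dim := by
    simpa using e.toLinearEquiv.finrank_eq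
  rw [sq_graphNorm f hρ, graphEnergy, ← Complex.re_ofReal_mul, Finset.mul_sum]
  congr 1
  refine Finset.sum_congr rfl fun a _ => ?_
  rw [Finset.mul_sum]
  refine Finset.sum_congr rfl fun b _ => ?_
  rw [char_iso e, character_outerTensor, hdim]
  simp only [IrrDual.dim_mk, IrrDual.character_mk, Prod.fst_mul, Prod.snd_mul, Prod.fst_inv,
    Prod.snd_inv]
  push_cast
  ring

theorem exists_isUnitary_equiv_outerTensor [Finite N] (σ : IrrRep K) (τ : IrrRep N) :
    ∃ ρ : IrrRep (K × N), ρ.IsUnitary ∧ Nonempty (ρ.rep.Equiv (outerTensor σ.rep τ.rep)) := by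
  obtain ⟨ρ, hρ, ⟨e⟩⟩ := IrrRep.exists_isUnitary_equiv (outerTensor σ.rep τ.rep)
    (σ.irreducible.outerTensor τ.irreducible)
  exact ⟨ρ, hρ, ⟨e.symm⟩⟩

open scoped Classical in
/-- Column orthogonality for `K` leaves only the diagonal terms `a = b`, each of which contributes
`|K|` times `∑_{t ≠ p} dim(t)² = |N| - 1`. -/
theorem sum_graphEnergy [Fintype N] [Fintype (IrrDual K)] [Fintype (IrrDual N)] (f : K → N)
    {p : IrrDual N} (hp_dim : p.dim = 1) (hp : ∀ g, p.character g = 1) :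
    ∑ q ∈ (Finset.univ : Finset (IrrDual K)) ×ˢ Finset.univ.erase p, graphEnergy f q.1 q.2 =
      (Fintype.card K : ℝ) ^ 2 * ((Fintype.card N : ℝ) - 1) := by
  have hN : ∀ x : N, ∑ t ∈ Finset.univ.erase p, (t.dim : ℂ) * t.character x =
      (if x = 1 then (Fintype.card N : ℂ) else 0) - 1 := fun x => by
    rw [← IrrDual.sum_dim_mul_character, ← Finset.add_sum_erase _ _ (Finset.mem_univ p)]
    simp [hp_dim, hp]
  simp only [graphEnergy]
  rw [← Complex.re_sum, Finset.sum_comm]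
  simp_rw [Finset.sum_comm (s := Finset.univ ×ˢ Finset.univ.erase p), Finset.sum_product,
    ← Finset.sum_mul_sum, hN, IrrDual.sum_dim_mul_character, mul_inv_eq_one, ite_mul, zero_mul]
  have : (∑ a : K, ∑ b : K, if a = b then (Fintype.card K : ℂ) *
      ((if f a = f b then (Fintype.card N : ℂ) else 0) - 1) else 0) =
      (((Fintype.card K : ℝ) ^ 2 * ((Fintype.card N : ℝ) - 1) : ℝ) : ℂ) := by
    simp only [Finset.sum_ite_eq, Finset.mem_univ, if_true, Finset.sum_const, Finset.card_univ,
      nsmul_eq_mul]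
    push_cast
    ring
  rw [this, Complex.ofReal_re]

end Graph

/-- A nontrivial finite group has a nonprincipal irreducible representation, since the squares of
the dimensions add up to the order. -/
theorem IrrDual.exists_ne_of_dim_eq_one {N : Type*} [Group N] [Fintype N] [Nontrivial N]
    {p : IrrDual N} (hp_dim : p.dim = 1) : ∃ t, t ≠ p := by
  by_contra! h
  have : Unique (IrrDual N) := ⟨⟨p⟩, h⟩
  have h1 := sum_dim_mul_character (1 : N)
  rw [Fintype.sum_unique, character_one, h default, hp_dim, if_pos rfl] at h1
  have h2 : (Fintype.card N : ℂ) = ((1 : ℕ) : ℂ) := by rw [← h1]; simp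
  exact Fintype.one_lt_card.ne' (Nat.cast_injective h2)

theorem theorem3p3 {K N : Type*} [Group K] [Fintype K] [Group N] [Fintype N] [Nontrivial N]
    (f : K → N) :
    ∃ M : ℝ,
      IsGreatest {x : ℝ | ∃ ρ : IrrRep (K × N), ρ.IsUnitary ∧ ρ.NonprincipalOnSnd ∧
        x = (ρ.dim : ℝ) * graphNorm f ρ ^ 2} M ∧
      (Fintype.card K : ℝ) ^ 2 * ((Fintype.card N : ℝ) - 1) /
        ((Nat.card (IrrDual K) : ℝ) * ((Nat.card (IrrDual N) : ℝ) - 1)) ≤ M ∧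
      (M = (Fintype.card K : ℝ) ^ 2 * ((Fintype.card N : ℝ) - 1) /
        ((Nat.card (IrrDual K) : ℝ) * ((Nat.card (IrrDual N) : ℝ) - 1)) ↔ IsBent f) := by
  classical
  have := Fintype.ofFinite (IrrDual K)
  have := Fintype.ofFinite (IrrDual N)
  obtain ⟨p, hp_dim, hp_char, hp⟩ := IrrDual.exists_principal N
  obtain ⟨s₀, -⟩ := IrrDual.exists_principal K
  obtain ⟨t₀, ht₀⟩ := IrrDual.exists_ne_of_dim_eq_one hp_dim
  set S := (Finset.univ : Finset (IrrDual K)) ×ˢ Finset.univ.erase p with hS_def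
  have hmem : ∀ s t, (s, t) ∈ S ↔ t ≠ p := fun s t => by simp [S]
  have hS : S.Nonempty := ⟨(s₀, t₀), (hmem _ _).2 ht₀⟩
  have hcard : (S.card : ℝ) =
      (Nat.card (IrrDual K) : ℝ) * ((Nat.card (IrrDual N) : ℝ) - 1) := by
    rw [hS_def, Finset.card_product, Finset.card_erase_of_mem (Finset.mem_univ p),
      Finset.card_univ, Finset.card_univ, Nat.cast_mul,
      Nat.cast_sub (Fintype.card_pos_iff.2 ⟨p⟩), Nat.card_eq_fintype_card,
      Nat.card_eq_fintype_card, Nat.cast_one]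
  let F : IrrDual K × IrrDual N → ℝ := fun q => graphEnergy f q.1 q.2
  have hset : {x : ℝ | ∃ ρ : IrrRep (K × N), ρ.IsUnitary ∧ ρ.NonprincipalOnSnd ∧
      x = (ρ.dim : ℝ) * graphNorm f ρ ^ 2} = F '' S := by
    ext x
    constructor
    · rintro ⟨ρ, hρ, ⟨σ, τ, ⟨e⟩, hτ⟩, rfl⟩
      exact ⟨(IrrDual.mk σ, IrrDual.mk τ), (hmem _ _).2 fun h => hτ ((hp τ).2 h),
        (dim_mul_sq_graphNorm f hρ e).symm⟩
    · rintro ⟨⟨s, t⟩, hst, rfl⟩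
      obtain ⟨σ, rfl⟩ := IrrDual.mk_surjective s
      obtain ⟨τ, rfl⟩ := IrrDual.mk_surjective t
      obtain ⟨ρ, hρ, ⟨e⟩⟩ := exists_isUnitary_equiv_outerTensor σ τ
      exact ⟨ρ, hρ, ⟨σ, τ, ⟨e⟩, fun h => (hmem _ _).1 hst ((hp τ).1 h)⟩,
        (dim_mul_sq_graphNorm f hρ e).symm⟩
  have hbent : IsBent f ↔ ∀ q ∈ S, graphEnergy f q.1 q.2 =
      (Fintype.card K : ℝ) ^ 2 * ((Fintype.card N : ℝ) - 1) /
        ((Nat.card (IrrDual K) : ℝ) * ((Nat.card (IrrDual N) : ℝ) - 1)) := by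
    have hρ_dim : ∀ ρ : IrrRep (K × N), (ρ.dim : ℝ) ≠ 0 := fun ρ => by
      simpa using ρ.irreducible.finrank_ne_zero
    constructor
    · intro h q hq
      have hx : graphEnergy f q.1 q.2 ∈ F '' S := ⟨q, hq, rfl⟩
      rw [← hset] at hx
      obtain ⟨ρ, hρ, hρ', hx⟩ := hx
      rw [hx, h ρ hρ hρ', mul_div_assoc', mul_div_mul_left _ _ (hρ_dim ρ)]
    · intro h ρ hρ hρ'
      have hx : (ρ.dim : ℝ) * graphNorm f ρ ^ 2 ∈ F '' S := by
        rw [← hset]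
        exact ⟨ρ, hρ, hρ', rfl⟩
      obtain ⟨q, hq, hx⟩ := hx
      dsimp only [F] at hx
      rw [h q hq] at hx
      rw [← mul_right_inj' (hρ_dim ρ), ← hx, mul_div_assoc', mul_div_mul_left _ _ (hρ_dim ρ)]
  have h := S.exists_isGreatest_average_le hS F
  dsimp only [F] at h hset
  rwa [sum_graphEnergy f hp_dim hp_char, hcard, ← hset, ← hbent] at h
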